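/- Let $\tau=\{t_k\}_{k=1}^\infty$ with $t_k\in[0,1]$. Let $H$ be a real Hilbert space. A dictionary in $H$ is a set $\mathcal D\subset H$ of unit vectors with $\overline{\operatorname{span}}\,\mathcal D=H$, and $A_1(\mathcal D)$ denotes the closure of the convex hull of $\mathcal D\cup(-\mathcal D)$. A realization of the Weak Greedy Algorithm WGA$(\mathcal D,\tau)$ for $f\in H$ consists of $f_0=f$ and, for each $m\ge1$, an element $\varphi_m\in\mathcal D$ with $|\langle f_{m-1},\varphi_m\rangle|\ge t_m\sup_{g\in\mathcal D}|\langle f_{m-1},g\rangle|$ and $f_m=f_{m-1}-\langle f_{m-1},\varphi_m\rangle\varphi_m$. The algorithm converges on a set $S\subset H$ if $\lim_{m\to\infty}\|f_m\|=0$ for each $f\in S$ and each realization for $f$. Consider the condition $$\text{for every } \{a_j\}_{j=1}^\infty\in\ell_2 \text{ with all } a_j\ge0:\qquad \liminf_{n\to\infty}\frac{a_n}{t_n}\sum_{j=1}^n a_j=0, \tag{$*$}$$ where the terms are taken in $[0,\infty]$, with $a/0=\infty$ for $a>0$ and $0/0=0$. (i) If $(*)$ holds, then for every real Hilbert space $H$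 and every dictionary $\mathcal D$ in $H$, WGA$(\mathcal D,\tau)$ converges on $A_1(\mathcal D)$ and, moreover, on all of $H$. (ii) For every infinite-dimensional real Hilbert space $H$, the condition $(*)$ is necessary and sufficient for WGA$(\mathcal D,\tau)$ to converge on $A_1(\mathcal D)$ for all dictionaries $\mathcal D$ in $H$. It is likewise necessary and sufficient for WGA$(\mathcal D,\tau)$ to converge on all of $H$ for all dictionaries $\mathcal D$ in $H$. -/

import Mathlib

namespace WeakGreedy

section Sequences

/-- A weakness sequence: all terms lie in `[0, 1]`. Throughout, sequences are indexed from `0`,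
so `t n` stands for the mathematical `t_{n+1}`. -/
def IsWeaknessSequence (t : ℕ → ℝ) : Prop :=
  ∀ n, 0 ≤ t n ∧ t n ≤ 1

/-- The condition: for every nonnegative square summable sequence `(a_j)`,
`liminf (a_n / t_n) * ∑_{j ≤ n} a_j = 0`.
The quotient is taken in `[0, ∞]`, so that `a_n / 0 = ∞` for `a_n > 0` (and `0 / 0 = 0`). The value
of `0 / 0` does not matter to the condition, since zero terms of `a` can be replaced by small
positive ones. -/
def LiminfCondition (t : ℕ → ℝ) : Prop :=
  ∀ a : ℕ → ℝ, (∀ j, 0 ≤ a j) → Summable (fun j => a j ^ 2) →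
    Filter.liminf
      (fun n => ENNReal.ofReal (a n) / ENNReal.ofReal (t n) *
        ENNReal.ofReal (∑ j ∈ Finset.range (n + 1), a j)) Filter.atTop = 0

end Sequences

section Hilbert

variable {H : Type*} [NormedAddCommGroup H] [InnerProductSpace ℝ H]

/-- A dictionary: a set of unit vectors whose linear span is dense. -/
def IsDictionary (D : Set H) : Prop :=
  (∀ g ∈ D, ‖g‖ = 1) ∧ closure (Submodule.span ℝ D : Set H) = Set.univ

/-- The generalized octahedron `A_1(D)`: the closed convex hull of `D ∪ (-D)`. -/
def octahedron (D : Set H) : Set H :=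
  closure (convexHull ℝ (D ∪ (fun g => -g) '' D))

/-- `r` is the sequence of residuals, and `φ` the sequence of chosen dictionary elements, of a
realization of the Weak Greedy Algorithm with weakness sequence `t` applied to `f`. Here `r m` is
the residual after `m` steps, and `φ m` is the element chosen at step `m + 1`.
The supremum is over a bounded set as the elements of a dictionary are unit vectors. -/
structure IsRealization (D : Set H) (t : ℕ → ℝ) (f : H) (φ r : ℕ → H) : Prop where
  init : r 0 = f
  mem : ∀ m, φ m ∈ D
  greedy : ∀ m, t m * (⨆ g : D, |inner ℝ (r m) (g : H)|) ≤ |inner ℝ (r m) (φ m)|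
  step : ∀ m, r (m + 1) = r m - inner ℝ (r m) (φ m) • φ m

/-- Every realization of the algorithm, for every `f` in the set `S`, has residuals tending to
zero in norm. -/
def ConvergesOn (D : Set H) (t : ℕ → ℝ) (S : Set H) : Prop :=
  ∀ f ∈ S, ∀ φ r : ℕ → H, IsRealization D t f φ r →
    Filter.Tendsto (fun m => ‖r m‖) Filter.atTop (nhds 0)

end Hilbert

end WeakGreedy

/-! Sufficiency. The coefficients `a n = |⟨r n, φ n⟩|` are square summable because each step removes
`a n ^ 2` from the squared norm. Where `t n > 0`, the greedy inequality bounds every `|⟨r n, g⟩|`,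
`g ∈ D`, by `a n / t n`. Expanding `r n - r m` in the chosen elements gives `|⟨r n - r m, r m⟩| ≤ (a
m / t m) * ∑ a j`, which is small for suitable arbitrarily large `m`. As the norms converge, `r` is
Cauchy. Its limit is orthogonal to `D`, hence zero (`LiminfCondition.convergesOn_univ`).

Necessity. If the condition fails, then after rescaling some `a` in `ℓ²` satisfies `t n ≤ a n * (∑ a
j) / 40` eventually. The dictionary consists of the vectors `α e_i - β e_j`. On a vector with
nonnegative coordinates none of them beats the largest coordinate. The adversary keeps the residual
nearly flat, so its largest coordinate is of the order of its squared norm divided by its mass.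
Moving weight from a largest coordinate to a small one, with inner product exactly `a n`, costs only
`a n ^ 2` of squared norm but raises the mass by at least `a n / 4`. So the mass grows like `T = m +
∑ a j`, the largest coordinate is at most `40 / T`, and `a n` is an admissible weak greedy choice
forever, while the norm stays bounded below (`EqualizerState.exists_step`). -/

namespace WeakGreedy

open Filter Topology

/-! ### Sufficiency: the residuals form a Cauchy sequence with limit zero. -/

section Sufficiency

variable {H : Type*} [NormedAddCommGroup H] [InnerProductSpace ℝ H]
  {D : Set H} {t : ℕ → ℝ} {f : H} {φ r : ℕ → H}

theorem IsDictionary.abs_inner_le (hD : IsDictionary D) (x : H) (g : D) :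
    |inner ℝ x (g : H)| ≤ ‖x‖ := by
  simpa [hD.1 g g.2] using abs_real_inner_le_norm x (g : H)

theorem IsDictionary.bddAbove (hD : IsDictionary D) (x : H) :
    BddAbove (Set.range fun g : D => |inner ℝ x (g : H)|) :=
  ⟨‖x‖, by rintro _ ⟨g, rfl⟩; exact hD.abs_inner_le x g⟩

theorem IsDictionary.eq_zero_of_inner_eq_zero (hD : IsDictionary D) {u : H}
    (h : ∀ g ∈ D, inner ℝ u g = 0) : u = 0 := by
  have hd : Dense (Submodule.span ℝ D : Set H) := dense_iff_closure_eq.mpr hD.2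
  refine hd.eq_zero_of_inner_left ℝ fun v (hv : v ∈ Submodule.span ℝ D) => ?_
  induction hv using Submodule.span_induction with
  | mem g hg => exact h g hg
  | zero => simp
  | add x y _ _ hx hy => rw [inner_add_right, hx, hy, add_zero]
  | smul c x _ hx => rw [inner_smul_right, hx, mul_zero]

theorem norm_sub_inner_smul_sq {x g : H} (hg : ‖g‖ = 1) :
    ‖x - inner ℝ x g • g‖ ^ 2 = ‖x‖ ^ 2 - inner ℝ x g ^ 2 := by
  rw [norm_sub_sq_real, inner_smul_right, norm_smul, hg, Real.norm_eq_abs, mul_one, sq_abs]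
  ring

namespace IsRealization

theorem norm_sq_succ (hD : IsDictionary D) (h : IsRealization D t f φ r) (n : ℕ) :
    ‖r (n + 1)‖ ^ 2 = ‖r n‖ ^ 2 - inner ℝ (r n) (φ n) ^ 2 := by
  rw [h.step, norm_sub_inner_smul_sq (hD.1 _ (h.mem n))]

theorem antitone_norm_sq (hD : IsDictionary D) (h : IsRealization D t f φ r) :
    Antitone fun n => ‖r n‖ ^ 2 :=
  antitone_nat_of_succ_le fun n => by
    rw [h.norm_sq_succ hD]; linarith [sq_nonneg (inner ℝ (r n) (φ n))]

theorem summable_inner_sq (hD : IsDictionary D) (h : IsRealization D t f φ r) :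
    Summable fun n => inner ℝ (r n) (φ n) ^ 2 := by
  refine summable_of_sum_range_le (c := ‖f‖ ^ 2) (fun n => sq_nonneg _) fun n => ?_
  have : ∑ i ∈ Finset.range n, inner ℝ (r i) (φ i) ^ 2 = ‖r 0‖ ^ 2 - ‖r n‖ ^ 2 := by
    rw [← Finset.sum_range_sub' (fun n => ‖r n‖ ^ 2)]
    exact Finset.sum_congr rfl fun i _ => by rw [h.norm_sq_succ hD]; ring
  rw [this, h.init]
  linarith [sq_nonneg ‖r n‖]

/-- The difference telescopes into multiples of the `φ j` with `n ≤ j < m`; summing over all `j < m`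
is wasteful but matches the liminf condition. It is used with `u = r m`. -/
theorem abs_inner_sub_le (h : IsRealization D t f φ r) {c : ℝ} {u : H}
    (hc : ∀ g ∈ D, |inner ℝ u g| ≤ c) {n m : ℕ} (hnm : n ≤ m) :
    |inner ℝ (r n - r m) u| ≤ c * ∑ j ∈ Finset.range m, |inner ℝ (r j) (φ j)| := by
  have hc0 : 0 ≤ c := (abs_nonneg _).trans (hc _ (h.mem 0))
  induction m, hnm using Nat.le_induction with
  | base =>
    simp only [sub_self, inner_zero_left, abs_zero]
    exact mul_nonneg hc0 (Finset.sum_nonneg fun _ _ => abs_nonneg _)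
  | succ m _ ih =>
    have e : r n - r (m + 1) = (r n - r m) + inner ℝ (r m) (φ m) • φ m := by
      rw [h.step]; abel
    rw [e, inner_add_left, real_inner_smul_left, Finset.sum_range_succ, mul_add]
    refine (abs_add_le _ _).trans (add_le_add ih ?_)
    rw [abs_mul, mul_comm, real_inner_comm]
    exact mul_le_mul_of_nonneg_right (hc _ (h.mem m)) (abs_nonneg _)

end IsRealization

/-- The liminf condition provides indices with positive weakness parameter along which the
quantity in question, and the ratio `a n / t n`, are small. -/
theorem LiminfCondition.exists_index (ht : IsWeaknessSequence t) (hL : LiminfCondition t)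
    {a : ℕ → ℝ} (ha : ∀ n, 0 ≤ a n) (hs : Summable fun n => a n ^ 2) {ε : ℝ} (hε : 0 < ε) (N : ℕ) :
    ∃ n ≥ N, 0 < t n ∧ a n / t n < ε ∧ a n / t n * ∑ j ∈ Finset.range n, a j < ε := by
  -- The geometric floor makes every term positive, so an index with `t n = 0` gives the value `∞`
  -- and is excluded. Since `b 0 ≥ 1`, the partial sums are at least `1`, and a small product forces
  -- a small ratio.
  set b : ℕ → ℝ := fun n => max (a n) ((1 / 2) ^ n) with hb
  have hb0 : ∀ n, 0 < b n := fun n => lt_max_of_lt_right (by positivity)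
  have hbs : Summable fun n => b n ^ 2 := by
    have h2 : Summable fun n : ℕ => (((1 : ℝ) / 2) ^ n) ^ 2 := by
      have : Summable fun n : ℕ => ((1 : ℝ) / 4) ^ n :=
        summable_geometric_of_lt_one (by norm_num) (by norm_num)
      refine this.congr fun n => ?_
      rw [← pow_mul, mul_comm, pow_mul]; norm_num
    refine Summable.of_nonneg_of_le (fun n => sq_nonneg _) (fun n => ?_) (hs.add h2)
    rcases max_cases (a n) ((1 / 2 : ℝ) ^ n) with h | h
    · simp only [hb, h.1]; linarith [sq_nonneg (((1 : ℝ) / 2) ^ n)]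
    · simp only [hb, h.1]; linarith [sq_nonneg (a n)]
  have hfreq : ∃ᶠ n in atTop, ENNReal.ofReal (b n) / ENNReal.ofReal (t n) *
      ENNReal.ofReal (∑ j ∈ Finset.range (n + 1), b j) < ENNReal.ofReal ε := by
    refine frequently_lt_of_liminf_lt (by isBoundedDefault) ?_
    rw [hL b (fun n => (hb0 n).le) hbs]
    exact ENNReal.ofReal_pos.mpr hε
  obtain ⟨n, hn, hlt⟩ := frequently_atTop.mp hfreq N
  have hS1 : 1 ≤ ∑ j ∈ Finset.range (n + 1), b j := by
    have : b 0 ≤ ∑ j ∈ Finset.range (n + 1), b j :=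
      Finset.single_le_sum (f := b) (fun j _ => (hb0 j).le) (by simp)
    refine le_trans ?_ this
    simp [hb]
  have htn : 0 < t n := by
    refine lt_of_le_of_ne (ht n).1 fun h0 => ?_
    rw [← h0, ENNReal.ofReal_zero, ENNReal.div_zero (by simpa using hb0 n),
      ENNReal.top_mul (by simp; linarith)] at hlt
    exact not_top_lt hlt
  rw [← ENNReal.ofReal_div_of_pos htn, ← ENNReal.ofReal_mul (div_nonneg (hb0 n).le htn.le),
    ENNReal.ofReal_lt_ofReal_iff hε] at hlt
  have hab : a n / t n ≤ b n / t n := by gcongr; exact le_max_left _ _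
  have hbt : 0 ≤ b n / t n := div_nonneg (hb0 n).le htn.le
  refine ⟨n, hn, htn, ?_, ?_⟩
  · nlinarith
  · refine lt_of_le_of_lt (mul_le_mul hab ?_ (Finset.sum_nonneg fun j _ => ha j) hbt) hlt
    rw [Finset.sum_range_succ]
    have : ∑ j ∈ Finset.range n, a j ≤ ∑ j ∈ Finset.range n, b j :=
      Finset.sum_le_sum fun j _ => le_max_left _ _
    linarith [hb0 n]

theorem LiminfCondition.convergesOn_univ [CompleteSpace H] (ht : IsWeaknessSequence t)
    (hL : LiminfCondition t) (hD : IsDictionary D) : ConvergesOn D t Set.univ := by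
  intro f _ φ r h
  set a : ℕ → ℝ := fun n => |inner ℝ (r n) (φ n)| with ha
  have ha0 : ∀ n, 0 ≤ a n := fun n => abs_nonneg _
  have has : Summable fun n => a n ^ 2 := by
    simpa only [ha, sq_abs] using h.summable_inner_sq hD
  have hidx := fun {ε : ℝ} (hε : 0 < ε) N => hL.exists_index ht ha0 has hε N
  have hgr : ∀ n, 0 < t n → ∀ g ∈ D, |inner ℝ (r n) g| ≤ a n / t n := by
    intro n hn g hg
    rw [le_div_iff₀ hn, mul_comm]
    exact (mul_le_mul_of_nonneg_left (le_ciSup (hD.bddAbove (r n)) ⟨g, hg⟩) hn.le).trans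
      (h.greedy n)
  have hcauchy : CauchySeq r := by
    have hconv : ∃ l, Tendsto (fun n => ‖r n‖ ^ 2) atTop (𝓝 l) :=
      ⟨_, tendsto_atTop_ciInf (h.antitone_norm_sq hD) ⟨0, by rintro _ ⟨n, rfl⟩; positivity⟩⟩
    obtain ⟨l, hl⟩ := hconv
    rw [Metric.cauchySeq_iff']
    intro ε hε
    -- The budget is `ε ^ 2 / 8 + 2 * (ε ^ 2 / 16) = (ε / 2) ^ 2`. Only special `m` are controlled,
    -- so `r n` and `r N` are compared through a common later `r m`.
    obtain ⟨N, hN⟩ := Metric.cauchySeq_iff.mp hl.cauchySeq (ε ^ 2 / 8) (by positivity)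
    have key : ∀ n ≥ N, ∀ m ≥ n, 0 < t m → a m / t m * ∑ j ∈ Finset.range m, a j < ε ^ 2 / 16 →
        ‖r n - r m‖ ^ 2 < (ε / 2) ^ 2 := by
      intro n hn m hm htm hsm
      have h1 := h.abs_inner_sub_le (hgr m htm) hm
      have h2 := hN n hn m (hn.trans hm)
      rw [Real.dist_eq] at h2
      have h3 : ‖r n - r m‖ ^ 2 = ‖r n‖ ^ 2 - ‖r m‖ ^ 2 - 2 * inner ℝ (r n - r m) (r m) := by
        rw [norm_sub_sq_real, inner_sub_left, real_inner_self_eq_norm_sq]; ring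
      have h4 := neg_abs_le (inner ℝ (r n - r m) (r m))
      have h5 := le_abs_self (‖r n‖ ^ 2 - ‖r m‖ ^ 2)
      rw [h3]
      nlinarith
    refine ⟨N, fun n hn => ?_⟩
    obtain ⟨m, hm, htm, -, hsm⟩ := hidx (ε := ε ^ 2 / 16) (by positivity) n
    have e1 := lt_of_pow_lt_pow_left₀ 2 (by positivity) (key n hn m hm htm hsm)
    have e2 := lt_of_pow_lt_pow_left₀ 2 (by positivity) (key N le_rfl m (hn.trans hm) htm hsm)
    rw [← dist_eq_norm] at e1 e2
    calc dist (r n) (r N) ≤ dist (r n) (r m) + dist (r N) (r m) := dist_triangle_right _ _ _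
      _ < ε := by linarith
  obtain ⟨u, hu⟩ := cauchySeq_tendsto_of_complete hcauchy
  have hu0 : u = 0 := by
    refine hD.eq_zero_of_inner_eq_zero fun g hg => ?_
    by_contra hne
    have hpos : 0 < |inner ℝ u g| := abs_pos.mpr hne
    have hlim : Tendsto (fun n => |inner ℝ (r n) g|) atTop (𝓝 |inner ℝ u g|) :=
      (hu.inner tendsto_const_nhds).abs
    obtain ⟨N, hN⟩ := eventually_atTop.mp (hlim.eventually_const_lt (half_lt_self hpos))
    obtain ⟨n, hn, htn, hlt, -⟩ := hidx (half_pos hpos) N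
    linarith [hgr n htn g hg, hN n hn]
  simpa [hu0] using hu.norm

end Sufficiency

/-! ### Necessity: the difference dictionary and spread vectors. -/

section Necessity

variable {ι H : Type*} [NormedAddCommGroup H] [InnerProductSpace ℝ H] {b : ι → H}

/-- The unit vectors `α e_i - β e_j` with nonnegative `α`, `β`, for an orthonormal family `e`. -/
def differenceDictionary (b : ι → H) : Set H :=
  {g | ∃ i j, ∃ α β : ℝ, i ≠ j ∧ 0 ≤ α ∧ 0 ≤ β ∧ α ^ 2 + β ^ 2 = 1 ∧ g = α • b i - β • b j}

/-- The sum of the coordinates. -/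
noncomputable def mass : (ι →₀ ℝ) →ₗ[ℝ] ℝ := Finsupp.linearCombination ℝ fun _ => 1

/-- A nonnegative vector all of whose nonzero coordinates, with at most one exception, are at least
a quarter of the largest one. -/
def IsSpread (x : ι →₀ ℝ) : Prop :=
  (∀ i, 0 ≤ x i) ∧ ∃ j, ∀ i, i ≠ j → x i = 0 ∨ ∀ k, x k ≤ 4 * x i

theorem mem_differenceDictionary [Nontrivial ι] (b : ι → H) (i : ι) :
    b i ∈ differenceDictionary b := by
  obtain ⟨j, hj⟩ := exists_ne i
  exact ⟨i, j, 1, 0, hj.symm, by simp, le_rfl, by simp, by simp⟩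

theorem norm_of_mem_differenceDictionary (hb : Orthonormal ℝ b) {g : H}
    (hg : g ∈ differenceDictionary b) : ‖g‖ = 1 := by
  obtain ⟨i, j, α, β, hij, -, -, h1, rfl⟩ := hg
  have : ‖α • b i - β • b j‖ ^ 2 = 1 := by
    rw [norm_sub_sq_real, real_inner_smul_left, real_inner_smul_right, hb.2 hij, norm_smul,
      norm_smul, hb.1 i, hb.1 j, Real.norm_eq_abs, Real.norm_eq_abs, mul_one, mul_one, sq_abs,
      sq_abs]
    linarith
  exact (pow_eq_one_iff_of_nonneg (norm_nonneg _) two_ne_zero).mp this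

theorem isDictionary_differenceDictionary [Nontrivial ι] (b : HilbertBasis ι ℝ H) :
    IsDictionary (differenceDictionary b) := by
  refine ⟨fun g hg => norm_of_mem_differenceDictionary b.orthonormal hg, ?_⟩
  have h := congrArg (fun K : Submodule ℝ H => (K : Set H)) b.dense_span
  simp only [Submodule.topologicalClosure_coe, Submodule.top_coe] at h
  refine Set.eq_univ_of_univ_subset (h ▸ closure_mono (Submodule.span_mono ?_))
  rintro _ ⟨i, rfl⟩
  exact mem_differenceDictionary b i

theorem inner_combination (hb : Orthonormal ℝ b) (x : ι →₀ ℝ) (i j : ι) (α β : ℝ) :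
    inner ℝ (Finsupp.linearCombination ℝ b x) (α • b i - β • b j) = α * x i - β * x j := by
  rw [inner_sub_right, real_inner_smul_right, real_inner_smul_right, hb.inner_left_finsupp,
    hb.inner_left_finsupp]
  simp

theorem norm_sq_combination (hb : Orthonormal ℝ b) (x : ι →₀ ℝ) :
    ‖Finsupp.linearCombination ℝ b x‖ ^ 2 = ∑ i ∈ x.support, x i ^ 2 := by
  rw [← real_inner_self_eq_norm_sq, hb.inner_finsupp_eq_sum_left, Finsupp.sum]
  exact Finset.sum_congr rfl fun i _ => by simp [sq]

theorem mass_eq_sum (x : ι →₀ ℝ) : mass x = ∑ i ∈ x.support, x i := by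
  simp [mass, Finsupp.linearCombination_apply, Finsupp.sum]

theorem mass_single (i : ι) (c : ℝ) : mass (Finsupp.single i c) = c := by
  simp [mass]

theorem exists_isMax {x : ι →₀ ℝ} (h0 : ∀ i, 0 ≤ x i) (hx : x ≠ 0) :
    ∃ i, 0 < x i ∧ ∀ k, x k ≤ x i := by
  obtain ⟨i, hi, hmax⟩ := x.support.exists_max_image x (Finsupp.support_nonempty_iff.mpr hx)
  have hpos : 0 < x i := lt_of_le_of_ne (h0 i) (Finsupp.mem_support_iff.mp hi).symm
  refine ⟨i, hpos, fun k => ?_⟩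
  by_cases hk : k ∈ x.support
  · exact hmax k hk
  · rw [Finsupp.notMem_support_iff.mp hk]; exact hpos.le

/-- Both `α * x i` and `β * x j` lie in `[0, c]`, hence so does the absolute value of their
difference. This is the role of the minus sign in the dictionary. -/
theorem abs_inner_le_of_mem_differenceDictionary (hb : Orthonormal ℝ b) {x : ι →₀ ℝ} {c : ℝ}
    (h0 : ∀ i, 0 ≤ x i) (hc : ∀ i, x i ≤ c) {g : H} (hg : g ∈ differenceDictionary b) :
    |inner ℝ (Finsupp.linearCombination ℝ b x) g| ≤ c := by
  obtain ⟨i, j, α, β, -, hα, hβ, h1, rfl⟩ := hg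
  rw [inner_combination hb, abs_le]
  have hα1 : α ≤ 1 := by nlinarith
  have hβ1 : β ≤ 1 := by nlinarith
  constructor <;> nlinarith [h0 i, h0 j, hc i, hc j, mul_nonneg hα (h0 i), mul_nonneg hβ (h0 j)]

theorem norm_sq_le_mul_mass (hb : Orthonormal ℝ b) {x : ι →₀ ℝ} {c : ℝ}
    (h0 : ∀ i, 0 ≤ x i) (hc : ∀ i, x i ≤ c) :
    ‖Finsupp.linearCombination ℝ b x‖ ^ 2 ≤ c * mass x := by
  rw [norm_sq_combination hb, mass_eq_sum, Finset.mul_sum]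
  exact Finset.sum_le_sum fun i _ => by nlinarith [h0 i, hc i]

/-- A nonexceptional `k` contributes `x i * x k ≤ 4 * x k ^ 2`; the exceptional one adds at most one
further squared norm, by the arithmetic-geometric mean inequality. -/
theorem IsSpread.mul_mass_le (hb : Orthonormal ℝ b) {x : ι →₀ ℝ} (hx : IsSpread x) (i : ι) :
    x i * mass x ≤ 5 * ‖Finsupp.linearCombination ℝ b x‖ ^ 2 := by
  classical
  obtain ⟨h0, j, hj⟩ := hx
  rw [norm_sq_combination hb, mass_eq_sum]
  set s := x.support
  have hle : ∀ k, x k ^ 2 ≤ ∑ l ∈ s, x l ^ 2 := by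
    intro k
    by_cases hk : k ∈ s
    · exact Finset.single_le_sum (f := fun l => x l ^ 2) (fun l _ => sq_nonneg _) hk
    · rw [Finsupp.notMem_support_iff.mp hk]
      simpa using Finset.sum_nonneg fun l (_ : l ∈ s) => sq_nonneg (x l)
  have hterm : ∀ k ∈ s, x i * x k ≤ 4 * x k ^ 2 + if k = j then x i * x j else 0 := by
    intro k _
    split_ifs with h
    · subst h; nlinarith [sq_nonneg (x k)]
    · rcases hj k h with h | h
      · simp [h]
      · nlinarith [h i, h0 k]
  calc x i * ∑ k ∈ s, x k = ∑ k ∈ s, x i * x k := Finset.mul_sum _ _ _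
    _ ≤ ∑ k ∈ s, (4 * x k ^ 2 + if k = j then x i * x j else 0) := Finset.sum_le_sum hterm
    _ = 4 * ∑ k ∈ s, x k ^ 2 + if j ∈ s then x i * x j else 0 := by
      rw [Finset.sum_add_distrib, Finset.mul_sum, Finset.sum_ite_eq']
    _ ≤ 5 * ∑ k ∈ s, x k ^ 2 := by
      have : (if j ∈ s then x i * x j else 0) ≤ ∑ k ∈ s, x k ^ 2 := by
        split_ifs
        · nlinarith [hle i, hle j, sq_nonneg (x i - x j)]
        · exact Finset.sum_nonneg fun l _ => sq_nonneg (x l)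
      linarith

/-! ### The equalizing step. -/

/-- Intermediate value theorem in `α`: the inner product is `-y ≤ 0` at `α = 0` and at least `x / 2
- y ≥ x / 4` at `α = 1 / 2`. -/
theorem exists_direction {x y a : ℝ} (hy0 : 0 ≤ y) (hy : y ≤ x / 4) (ha0 : 0 ≤ a)
    (ha : a ≤ x / 4) :
    ∃ α β : ℝ, 0 ≤ α ∧ α ≤ 1 / 2 ∧ 3 / 4 ≤ β ∧ β ≤ 1 ∧ α ^ 2 + β ^ 2 = 1 ∧ α * x - β * y = a := by
  have hcont : ContinuousOn (fun α : ℝ => α * x - √(1 - α ^ 2) * y) (Set.Icc 0 (1 / 2)) := by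
    fun_prop
  have hs : √(1 - (1 / 2 : ℝ) ^ 2) ≤ 1 := Real.sqrt_le_one.mpr (by norm_num)
  obtain ⟨α, ⟨h0, h1⟩, hα⟩ := intermediate_value_Icc (by norm_num) hcont
    (show a ∈ Set.Icc _ _ from ⟨by simp; linarith, by nlinarith⟩)
  refine ⟨α, √(1 - α ^ 2), h0, h1, Real.le_sqrt_of_sq_le (by nlinarith),
    Real.sqrt_le_one.mpr (by nlinarith), ?_, hα⟩
  rw [Real.sq_sqrt (by nlinarith)]
  ring

/-- One step of the equalizing procedure: a small amount is moved from a largest coordinate to the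
exceptional small coordinate, or to a fresh one. -/
theorem IsSpread.exists_transfer [Infinite ι] {x : ι →₀ ℝ} (hx : IsSpread x) {i : ι}
    (hi : 0 < x i) (hmax : ∀ k, x k ≤ x i) {a : ℝ} (ha0 : 0 ≤ a) (ha : a ≤ x i / 4) :
    ∃ j, ∃ α β : ℝ, i ≠ j ∧ 0 ≤ α ∧ 0 ≤ β ∧ α ^ 2 + β ^ 2 = 1 ∧ α * x i - β * x j = a ∧
      1 / 4 ≤ β - α ∧ β - α ≤ 1 ∧
      IsSpread (x - a • (Finsupp.single i α - Finsupp.single j β)) := by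
  classical
  obtain ⟨h0, j₀, hj₀⟩ := hx
  -- If the exceptional coordinate has grown past `x i / 4` it is no longer exceptional, and an
  -- index outside the support takes over its role.
  have hj : ∃ j, x j ≤ x i / 4 ∧ ∀ k, k ≠ j → x k = 0 ∨ x i ≤ 4 * x k := by
    by_cases hc : x j₀ ≤ x i / 4
    · exact ⟨j₀, hc, fun k hk => (hj₀ k hk).imp_right fun h => h i⟩
    · obtain ⟨j, hj⟩ := Infinite.exists_notMem_finset x.support
      refine ⟨j, by rw [Finsupp.notMem_support_iff.mp hj]; linarith, fun k _ => ?_⟩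
      by_cases hk : k = j₀
      · subst hk; right; linarith
      · exact (hj₀ k hk).imp_right fun h => h i
  obtain ⟨j, hjle, hj⟩ := hj
  have hij : i ≠ j := by rintro rfl; linarith
  obtain ⟨α, β, hα0, hα, hβ, hβ1, h1, he⟩ := exists_direction (h0 j) hjle ha0 ha
  refine ⟨j, α, β, hij, hα0, by linarith, h1, he, by linarith, by linarith, ?_⟩
  set y := x - a • (Finsupp.single i α - Finsupp.single j β) with hy
  have yi : y i = x i - a * α := by simp [hy, hij]
  have yj : y j = x j + a * β := by simp [hy, hij.symm]
  have yk : ∀ k, k ≠ i → k ≠ j → y k = x k := fun k h h' => by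
    simp [hy, h.symm, h'.symm]
  have haα : 0 ≤ a * α := mul_nonneg ha0 hα0
  have haα' : a * α ≤ x i / 8 := by nlinarith
  have haβ : 0 ≤ a * β := mul_nonneg ha0 (by linarith)
  have haβ' : a * β ≤ x i / 4 := by nlinarith
  have ymax : ∀ k, y k ≤ x i := by
    intro k
    by_cases hki : k = i
    · subst hki; linarith
    · by_cases hkj : k = j
      · subst hkj; linarith
      · rw [yk k hki hkj]; exact hmax k
  refine ⟨fun k => ?_, j, fun k hkj => ?_⟩
  · by_cases hki : k = i
    · subst hki; linarith
    · by_cases hkj : k = j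
      · subst hkj; linarith [h0 k]
      · rw [yk k hki hkj]; exact h0 k
  · by_cases hki : k = i
    · subst hki; right; intro l; linarith [ymax l]
    · rw [yk k hki hkj]
      exact (hj k hkj).imp_right fun h l => (ymax l).trans h

theorem IsSpread.sub_single {x : ι →₀ ℝ} (hx : IsSpread x) (i : ι) :
    IsSpread (x - Finsupp.single i (x i)) := by
  classical
  obtain ⟨h0, j, hj⟩ := hx
  have hi : (x - Finsupp.single i (x i)) i = 0 := by simp
  have hk : ∀ k, k ≠ i → (x - Finsupp.single i (x i)) k = x k := fun k h => by
    simp [h.symm]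
  have hle : ∀ k, (x - Finsupp.single i (x i)) k ≤ x k := by
    intro k
    by_cases h : k = i
    · subst h; rw [hi]; exact h0 k
    · rw [hk k h]
  refine ⟨fun k => ?_, j, fun k hkj => ?_⟩
  · by_cases h : k = i
    · subst h; rw [hi]
    · rw [hk k h]; exact h0 k
  · by_cases h : k = i
    · subst h; left; exact hi
    · rw [hk k h]
      exact (hj k hkj).imp_right fun h l => (hle l).trans (h l)

/-- The bounds maintained during the equalizing procedure with total path length `T` and
quadratic loss `Q`. -/
structure EqualizerState (b : ι → H) (T Q : ℝ) (x : ι →₀ ℝ) : Prop where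
  spread : IsSpread x
  norm_le : ‖Finsupp.linearCombination ℝ b x‖ ^ 2 ≤ 1
  le_norm : 1 - 16 * Q ≤ ‖Finsupp.linearCombination ℝ b x‖ ^ 2
  mass_le : mass x ≤ T
  le_mass : T / 4 - 40 * T * Q ≤ mass x

/-- The bound on `Q` keeps the mass above `T / 8` and the squared norm above `1 / 2`. With
`IsSpread.mul_mass_le` this gives `x i * T ≤ 40`, the source of the `40` in `hta`. -/
theorem EqualizerState.exists_step [Infinite ι] (hb : Orthonormal ℝ b) {T Q a t : ℝ}
    (hT : 0 < T) (hQ0 : 0 ≤ Q) (hQ : Q ≤ 1 / 320) (ha : 0 ≤ a) (ht0 : 0 ≤ t) (ht1 : t ≤ 1)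
    (hta : t ≤ a * T / 40) {x : ι →₀ ℝ} (hx : EqualizerState b T Q x) :
    ∃ y : ι →₀ ℝ, EqualizerState b (T + a) (Q + a ^ 2) y ∧ ∃ g ∈ differenceDictionary b,
      Finsupp.linearCombination ℝ b y = Finsupp.linearCombination ℝ b x -
        inner ℝ (Finsupp.linearCombination ℝ b x) g • g ∧
      ∀ g' ∈ differenceDictionary b, t * |inner ℝ (Finsupp.linearCombination ℝ b x) g'| ≤
        |inner ℝ (Finsupp.linearCombination ℝ b x) g| := by
  set v := Finsupp.linearCombination ℝ b x with hv
  have hvpos : 1 / 2 ≤ ‖v‖ ^ 2 := by linarith [hx.le_norm]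
  have hx0 : x ≠ 0 := by
    rintro rfl
    norm_num [hv] at hvpos
  have hnn := hx.spread.1
  obtain ⟨i, hi, hmax⟩ := exists_isMax hnn hx0
  have hM := norm_sq_le_mul_mass hb hnn hmax
  have hM' := hx.spread.mul_mass_le hb i
  rw [← hv] at hM hM'
  have hle := hx.mass_le
  have hge := hx.le_mass
  have hn1 := hx.norm_le
  have hn2 := hx.le_norm
  rw [← hv] at hn1 hn2
  have hTQ : 40 * T * Q ≤ T / 8 := by linarith [mul_le_mul_of_nonneg_left hQ hT.le]
  have hsup : ∀ g' ∈ differenceDictionary b, t * |inner ℝ v g'| ≤ t * x i := fun g' hg' =>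
    mul_le_mul_of_nonneg_left (abs_inner_le_of_mem_differenceDictionary hb hnn hmax hg') ht0
  by_cases hsmall : a ≤ x i / 4
  · obtain ⟨j, α, β, hij, hα, hβ, h1, he, hl, hu, hsp⟩ :=
      hx.spread.exists_transfer hi hmax ha hsmall
    set g := α • b i - β • b j with hg
    have hgD : g ∈ differenceDictionary b := ⟨i, j, α, β, hij, hα, hβ, h1, rfl⟩
    have hin : inner ℝ v g = a := by rw [hg, hv, inner_combination hb, he]
    have hstep : Finsupp.linearCombination ℝ b
        (x - a • (Finsupp.single i α - Finsupp.single j β)) = v - inner ℝ v g • g := by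
      rw [hin, map_sub, map_smul, map_sub, Finsupp.linearCombination_single,
        Finsupp.linearCombination_single]
    have hmass : mass (x - a • (Finsupp.single i α - Finsupp.single j β)) =
        mass x + a * (β - α) := by
      rw [map_sub, map_smul, map_sub, mass_single, mass_single, smul_eq_mul]; ring
    have hnorm := norm_sub_inner_smul_sq (x := v) (norm_of_mem_differenceDictionary hb hgD)
    rw [← hstep, hin] at hnorm
    refine ⟨_, ⟨hsp, ?_, ?_, ?_, ?_⟩, g, hgD, hstep, fun g' hg' => (hsup g' hg').trans ?_⟩
    · linarith [sq_nonneg a]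
    · linarith [sq_nonneg a]
    · rw [hmass]; linarith [mul_le_of_le_one_right ha hu]
    · rw [hmass]
      have h1 : T * Q ≤ (T + a) * (Q + a ^ 2) :=
        mul_le_mul (by linarith) (by linarith [sq_nonneg a]) hQ0 (by linarith)
      linarith [mul_le_mul_of_nonneg_left hl ha]
    · rw [hin, abs_of_nonneg ha]
      have hxT : x i * (T / 8) ≤ x i * mass x := mul_le_mul_of_nonneg_left (by linarith) hi.le
      calc t * x i ≤ a * T / 40 * x i := mul_le_mul_of_nonneg_right hta hi.le
        _ = a * (x i * T / 40) := by ring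
        _ ≤ a := mul_le_of_le_one_right ha (by linarith)
  -- When `a` is too large for a transfer, the largest coordinate is deleted, which is a fully
  -- greedy step. It loses `x i ^ 2 ≤ 16 * a ^ 2` of squared norm. From `1 / 2 ≤ x i * mass x ≤ 4 *
  -- a * T` comes `a ≤ 8 * a ^ 2 * T`, so the term `40 * T * Q` absorbs the lost mass.
  · push Not at hsmall
    have hgD := mem_differenceDictionary b i
    have hin : inner ℝ v (b i) = x i := by
      rw [hv, hb.inner_left_finsupp]; simp
    have hstep : Finsupp.linearCombination ℝ b (x - Finsupp.single i (x i)) =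
        v - inner ℝ v (b i) • b i := by
      rw [hin, map_sub, Finsupp.linearCombination_single]
    have hmass : mass (x - Finsupp.single i (x i)) = mass x - x i := by
      rw [map_sub, mass_single]
    have hnorm := norm_sub_inner_smul_sq (x := v) (norm_of_mem_differenceDictionary hb hgD)
    rw [← hstep, hin] at hnorm
    refine ⟨_, ⟨hx.spread.sub_single i, ?_, ?_, ?_, ?_⟩, b i, hgD, hstep,
      fun g' hg' => (hsup g' hg').trans ?_⟩
    · linarith [sq_nonneg (x i)]
    · have : x i ^ 2 ≤ (4 * a) ^ 2 := pow_le_pow_left₀ hi.le (by linarith) 2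
      linarith
    · rw [hmass]; linarith
    · rw [hmass]
      have h8 : x i * mass x ≤ 4 * a * T :=
        mul_le_mul (by linarith) hle (by linarith) (by linarith)
      have h5 : a * 1 ≤ a * (8 * a * T) := mul_le_mul_of_nonneg_left (by linarith) ha
      have : T * (Q + a ^ 2) ≤ (T + a) * (Q + a ^ 2) :=
        mul_le_mul_of_nonneg_right (by linarith) (by positivity)
      linarith
    · rw [hin, abs_of_pos hi]; exact mul_le_of_le_one_left hi.le ht1

/-! ### Divergent realizations built from the equalizing steps. -/

/-- Some realization with weakness sequence `t`, started at a nonzero nonnegative combination of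
the orthonormal vectors, has residuals that do not tend to zero. -/
def HasDivergentRealization (b : ι → H) (t : ℕ → ℝ) : Prop :=
  ∃ x : ι →₀ ℝ, x ≠ 0 ∧ (∀ i, 0 ≤ x i) ∧ ∃ φ r : ℕ → H,
    IsRealization (differenceDictionary b) t (Finsupp.linearCombination ℝ b x) φ r ∧
      ¬ Tendsto (fun m => ‖r m‖) atTop (𝓝 0)

/-- Take `m ^ 2` coordinates equal to `1 / m`: the norm is `1` and the mass is `m`. -/
theorem exists_equal_state [Infinite ι] (hb : Orthonormal ℝ b) {m : ℕ} (hm : 0 < m) :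
    ∃ x : ι →₀ ℝ, EqualizerState b m 0 x := by
  classical
  obtain ⟨s, hs⟩ := Infinite.exists_subset_card_eq ι (m ^ 2)
  have hm' : (0 : ℝ) < m := by exact_mod_cast hm
  set x : ι →₀ ℝ := Finsupp.indicator s fun _ _ => (1 / m : ℝ) with hxdef
  have hxs : ∀ k ∈ s, x k = 1 / m := fun k hk => by simp [hxdef, hk]
  have hxn : ∀ k, k ∉ s → x k = 0 := fun k hk => by simp [hxdef, hk]
  have hpos : (0 : ℝ) < 1 / m := by positivity
  have hsupp : x.support = s := by
    ext k
    rw [Finsupp.mem_support_iff]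
    by_cases hk : k ∈ s
    · simp only [hxs k hk, hk, iff_true]; exact hpos.ne'
    · simp [hxn k hk, hk]
  have hnorm : ‖Finsupp.linearCombination ℝ b x‖ ^ 2 = 1 := by
    rw [norm_sq_combination hb, hsupp, Finset.sum_congr rfl fun k hk => by rw [hxs k hk],
      Finset.sum_const, hs]
    simp only [nsmul_eq_mul, Nat.cast_pow]; field_simp
  have hmass : mass x = m := by
    rw [mass_eq_sum, hsupp, Finset.sum_congr rfl fun k hk => by rw [hxs k hk],
      Finset.sum_const, hs]
    simp only [nsmul_eq_mul, Nat.cast_pow]; field_simp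
  refine ⟨x, ⟨⟨fun k => ?_, Classical.arbitrary ι, fun k _ => ?_⟩, hnorm.le, by simp [hnorm],
    hmass.le, by rw [hmass]; linarith⟩⟩
  · by_cases hk : k ∈ s
    · rw [hxs k hk]; exact hpos.le
    · rw [hxn k hk]
  · by_cases hk : k ∈ s
    · right
      intro l
      rw [hxs k hk]
      by_cases hl : l ∈ s
      · rw [hxs l hl]; linarith
      · rw [hxn l hl]; linarith
    · left; exact hxn k hk

theorem hasDivergentRealization_of_le [Infinite ι] (hb : Orthonormal ℝ b) {t a : ℕ → ℝ}
    (ht : IsWeaknessSequence t) (ha : ∀ n, 0 ≤ a n) {m : ℕ} (hm : 0 < m)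
    (hQ : ∀ n, ∑ j ∈ Finset.range n, a j ^ 2 ≤ 1 / 320)
    (hta : ∀ n, t n ≤ a n * (m + ∑ j ∈ Finset.range n, a j) / 40) :
    HasDivergentRealization b t := by
  set T : ℕ → ℝ := fun n => m + ∑ j ∈ Finset.range n, a j with hT
  set Q : ℕ → ℝ := fun n => ∑ j ∈ Finset.range n, a j ^ 2 with hQdef
  have hm' : (0 : ℝ) < m := by exact_mod_cast hm
  have hTpos : ∀ n, 0 < T n := fun n =>
    add_pos_of_pos_of_nonneg hm' (Finset.sum_nonneg fun j _ => ha j)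
  have hQ0 : ∀ n, 0 ≤ Q n := fun n => Finset.sum_nonneg fun j _ => sq_nonneg _
  have step : ∀ n (x : {x : ι →₀ ℝ // EqualizerState b (T n) (Q n) x}),
      ∃ y : {y : ι →₀ ℝ // EqualizerState b (T (n + 1)) (Q (n + 1)) y},
        ∃ g ∈ differenceDictionary b,
        Finsupp.linearCombination ℝ b y.1 = Finsupp.linearCombination ℝ b x.1 -
          inner ℝ (Finsupp.linearCombination ℝ b x.1) g • g ∧
        ∀ g' ∈ differenceDictionary b, t n * |inner ℝ (Finsupp.linearCombination ℝ b x.1) g'| ≤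
          |inner ℝ (Finsupp.linearCombination ℝ b x.1) g| := by
    rintro n ⟨x, hx⟩
    obtain ⟨y, hy, hyg⟩ := hx.exists_step hb (hTpos n) (hQ0 n) (hQ n) (ha n) (ht n).1 (ht n).2
      (hta n)
    refine ⟨⟨y, ?_⟩, hyg⟩
    have e1 : T (n + 1) = T n + a n := by simp only [hT, Finset.sum_range_succ]; ring
    have e2 : Q (n + 1) = Q n + a n ^ 2 := by simp only [hQdef, Finset.sum_range_succ]
    rw [e1, e2]; exact hy
  choose next dir hdir hnext hgreedy using step
  obtain ⟨x₀, hx₀⟩ := exists_equal_state hb hm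
  let state : (n : ℕ) → {x : ι →₀ ℝ // EqualizerState b (T n) (Q n) x} := fun n =>
    Nat.rec ⟨x₀, by simpa [hT, hQdef] using hx₀⟩ (fun n x => next n x) n
  have hbig : ∀ n, 1 / 2 ≤ ‖Finsupp.linearCombination ℝ b (state n).1‖ ^ 2 := fun n => by
    have := (state n).2.le_norm
    linarith [show Q n ≤ 1 / 320 from hQ n]
  refine ⟨x₀, ?_, hx₀.spread.1, fun n => dir n (state n),
    fun n => Finsupp.linearCombination ℝ b (state n).1,
    ⟨rfl, fun n => hdir _ _, fun n => ?_, fun n => hnext n (state n)⟩, fun hlim => ?_⟩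
  · rintro rfl
    have : (1 : ℝ) / 2 ≤ ‖Finsupp.linearCombination ℝ b (0 : ι →₀ ℝ)‖ ^ 2 := hbig 0
    norm_num at this
  · rw [Real.mul_iSup_of_nonneg (ht n).1]
    exact Real.iSup_le (fun g => hgreedy n (state n) g g.2) (abs_nonneg _)
  · have h2 := hlim.pow 2
    have := ge_of_tendsto' h2 hbig
    norm_num at this

/-- Add a fresh coordinate equal to the largest one. Removing it is a fully greedy first step,
admissible for any `t 0 ≤ 1`, and leads back to the given start. Thus finitely many terms of `t` do
not matter. -/
theorem HasDivergentRealization.of_shift [Infinite ι] (hb : Orthonormal ℝ b) {t : ℕ → ℝ}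
    (ht0 : 0 ≤ t 0) (ht1 : t 0 ≤ 1) (h : HasDivergentRealization b fun n => t (n + 1)) :
    HasDivergentRealization b t := by
  classical
  obtain ⟨x, hx, h0, φ, r, hr, hlim⟩ := h
  obtain ⟨i, hi, hmax⟩ := exists_isMax h0 hx
  obtain ⟨j, hj⟩ := Infinite.exists_notMem_finset x.support
  rw [Finsupp.notMem_support_iff] at hj
  set y := x + Finsupp.single j (x i) with hy
  have yj : y j = x i := by simp [hy, hj]
  have yk : ∀ k, k ≠ j → y k = x k := fun k hk => by simp [hy, hk.symm]
  have hy0 : ∀ k, 0 ≤ y k := fun k => by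
    by_cases hk : k = j
    · subst hk; rw [yj]; exact hi.le
    · rw [yk k hk]; exact h0 k
  have hymax : ∀ k, y k ≤ x i := fun k => by
    by_cases hk : k = j
    · subst hk; rw [yj]
    · rw [yk k hk]; exact hmax k
  have hin : inner ℝ (Finsupp.linearCombination ℝ b y) (b j) = x i := by
    rw [hb.inner_left_finsupp, yj]; simp
  refine ⟨y, fun hc => ?_, hy0, fun n => Nat.casesOn n (b j) φ,
    fun n => Nat.casesOn n (Finsupp.linearCombination ℝ b y) r, ⟨rfl, ?_, ?_, ?_⟩, fun hl => ?_⟩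
  · rw [hc] at yj
    exact hi.ne yj
  · rintro (_ | n)
    · exact mem_differenceDictionary b j
    · exact hr.mem n
  · rintro (_ | n)
    · change t 0 * (⨆ g : differenceDictionary b,
        |inner ℝ (Finsupp.linearCombination ℝ b y) (g : H)|) ≤
        |inner ℝ (Finsupp.linearCombination ℝ b y) (b j)|
      rw [hin, abs_of_pos hi]
      have : (⨆ g : differenceDictionary b,
          |inner ℝ (Finsupp.linearCombination ℝ b y) (g : H)|) ≤ x i :=
        Real.iSup_le (fun g => abs_inner_le_of_mem_differenceDictionary hb hy0 hymax g.2) hi.le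
      nlinarith
    · exact hr.greedy n
  · rintro (_ | n)
    · change r 0 = Finsupp.linearCombination ℝ b y -
        inner ℝ (Finsupp.linearCombination ℝ b y) (b j) • b j
      rw [hin, hr.init, hy, map_add, Finsupp.linearCombination_single, add_sub_cancel_right]
    · exact hr.step n
  · exact hlim ((tendsto_add_atTop_iff_nat 1).mpr hl)

theorem HasDivergentRealization.of_shift_add [Infinite ι] (hb : Orthonormal ℝ b) (N : ℕ) :
    ∀ {t : ℕ → ℝ}, IsWeaknessSequence t → HasDivergentRealization b (fun n => t (n + N)) →
      HasDivergentRealization b t := by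
  induction N with
  | zero => exact fun _ h => h
  | succ N ih =>
    intro t ht h
    refine ih ht (HasDivergentRealization.of_shift hb (ht _).1 (ht _).2 ?_)
    convert h using 3
    omega

theorem IsRealization.smul {D : Set H} {t : ℕ → ℝ} {f : H} {φ r : ℕ → H}
    (h : IsRealization D t f φ r) (c : ℝ) :
    IsRealization D t (c • f) φ fun n => c • r n where
  init := by rw [h.init]
  mem := h.mem
  greedy n := by
    simp only [real_inner_smul_left, abs_mul]
    rw [← Real.mul_iSup_of_nonneg (abs_nonneg c), mul_left_comm]
    exact mul_le_mul_of_nonneg_left (h.greedy n) (abs_nonneg c)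
  step n := by rw [h.step, smul_sub, real_inner_smul_left, smul_smul]

/-- Realizations scale, and dividing the start by its mass makes it a convex combination of the `b
k`. -/
theorem HasDivergentRealization.not_convergesOn [Nontrivial ι] {t : ℕ → ℝ}
    (h : HasDivergentRealization b t) :
    ¬ ConvergesOn (differenceDictionary b) t (octahedron (differenceDictionary b)) := by
  intro hconv
  obtain ⟨x, hx, h0, φ, r, hr, hlim⟩ := h
  obtain ⟨i, hi, -⟩ := exists_isMax h0 hx
  have hmass : 0 < mass x := by
    rw [mass_eq_sum]
    exact Finset.sum_pos' (fun k _ => h0 k) ⟨i, Finsupp.mem_support_iff.mpr hi.ne', hi⟩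
  set c := (mass x)⁻¹ with hc
  have hcpos : 0 < c := inv_pos.mpr hmass
  have hmem : c • Finsupp.linearCombination ℝ b x ∈ octahedron (differenceDictionary b) := by
    refine subset_closure ?_
    rw [Finsupp.linearCombination_apply, Finsupp.sum, Finset.smul_sum]
    simp_rw [smul_smul]
    refine (convex_convexHull ℝ _).sum_mem (fun k _ => mul_nonneg hcpos.le (h0 k)) ?_ fun k _ =>
      subset_convexHull ℝ _ (Or.inl (mem_differenceDictionary b k))
    rw [← Finset.mul_sum, ← mass_eq_sum, hc, inv_mul_cancel₀ hmass.ne']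
  refine hlim ?_
  have := (hconv _ hmem _ _ (hr.smul c)).const_mul c⁻¹
  simpa [norm_smul, abs_of_pos hcpos, hcpos.ne'] using this

/-! ### From failure of the liminf condition to divergence. -/

theorem exists_bound_of_not_liminfCondition {t : ℕ → ℝ} (ht : IsWeaknessSequence t)
    (h : ¬ LiminfCondition t) :
    ∃ a : ℕ → ℝ, (∀ n, 0 ≤ a n) ∧ (Summable fun n => a n ^ 2) ∧
      ∃ N, ∀ n ≥ N, t n ≤ a n * (∑ j ∈ Finset.range (n + 1), a j) / 40 := by
  simp only [LiminfCondition, not_forall] at h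
  obtain ⟨a, ha, hs, hne⟩ := h
  obtain ⟨c, hc0, hc⟩ := ENNReal.lt_iff_exists_nnreal_btwn.mp (pos_iff_ne_zero.mpr hne)
  obtain ⟨N, hN⟩ := eventually_atTop.mp (eventually_lt_of_lt_liminf hc (by isBoundedDefault))
  have hc0' : (0 : ℝ) < c := by exact_mod_cast hc0
  -- The product `a n * ∑ a j` is quadratic in `a`, so scaling by `A` multiplies it by `40 / c`.
  set A := √(40 / c) with hA
  have hA2 : A ^ 2 = 40 / c := Real.sq_sqrt (by positivity)
  refine ⟨fun n => A * a n, fun n => mul_nonneg (Real.sqrt_nonneg _) (ha n), ?_, N,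
    fun n hn => ?_⟩
  · simpa only [mul_pow] using hs.mul_left (A ^ 2)
  · have hS : 0 ≤ ∑ j ∈ Finset.range (n + 1), a j := Finset.sum_nonneg fun j _ => ha j
    have key : c * t n ≤ a n * ∑ j ∈ Finset.range (n + 1), a j := by
      rcases (ht n).1.eq_or_lt with h0 | hpos
      · rw [← h0, mul_zero]; exact mul_nonneg (ha n) hS
      · have h1 := hN n hn
        rw [← ENNReal.ofReal_div_of_pos hpos,
          ← ENNReal.ofReal_mul (div_nonneg (ha n) hpos.le), ← ENNReal.ofReal_coe_nnreal] at h1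
        have h2 := (ENNReal.ofReal_lt_ofReal_iff_of_nonneg c.2).mp h1
        rw [div_mul_eq_mul_div, lt_div_iff₀ hpos] at h2
        exact h2.le
    rw [← Finset.mul_sum]
    calc t n = c * t n / c := by field_simp
      _ ≤ (a n * ∑ j ∈ Finset.range (n + 1), a j) / c := by gcongr
      _ = A ^ 2 * (a n * ∑ j ∈ Finset.range (n + 1), a j) / 40 := by rw [hA2]; field_simp
      _ = _ := by ring

theorem hasDivergentRealization_of_not_liminfCondition [Infinite ι] (hb : Orthonormal ℝ b)
    {t : ℕ → ℝ} (ht : IsWeaknessSequence t) (h : ¬ LiminfCondition t) :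
    HasDivergentRealization b t := by
  obtain ⟨a, ha, hs, N, hN⟩ := exists_bound_of_not_liminfCondition ht h
  have htail : ∀ᶠ k in atTop, ∑' n, a (n + k) ^ 2 < 1 / 320 :=
    (tendsto_sum_nat_add fun n => a n ^ 2).eventually_lt_const (by norm_num)
  obtain ⟨K, hK, hNK⟩ := (htail.and (eventually_ge_atTop N)).exists
  have hsK : Summable fun n => a (n + K) ^ 2 := (summable_nat_add_iff K).mpr hs
  have hQ : ∀ n, ∑ j ∈ Finset.range n, a (j + K) ^ 2 ≤ 1 / 320 := fun n =>
    (hsK.sum_le_tsum _ fun _ _ => sq_nonneg _).trans hK.le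
  have ha1 : ∀ n, a (n + K) ≤ 1 := by
    intro n
    have h1 := (hsK.le_tsum n fun _ _ => sq_nonneg _).trans hK.le
    nlinarith [ha (n + K)]
  -- The initial mass `m` pays for the discarded terms; the extra `1` covers the last term `a (n +
  -- K) ≤ 1`, which the condition includes but `T` does not.
  obtain ⟨m, hm⟩ := exists_nat_ge (∑ j ∈ Finset.range K, a j + 1)
  have hmpos : 0 < m := by
    have : (0 : ℝ) < m :=
      lt_of_lt_of_le (by linarith [Finset.sum_nonneg fun j (_ : j ∈ Finset.range K) => ha j]) hm
    exact_mod_cast this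
  refine HasDivergentRealization.of_shift_add hb K ht
    (hasDivergentRealization_of_le hb (fun n => ht (n + K)) (fun n => ha (n + K)) hmpos hQ
      fun n => ?_)
  refine (hN (n + K) (by omega)).trans ?_
  have e : ∑ j ∈ Finset.range (n + K + 1), a j =
      ∑ j ∈ Finset.range K, a j + ∑ j ∈ Finset.range n, a (j + K) + a (n + K) := by
    rw [Finset.sum_range_succ, add_comm n K, Finset.sum_range_add]
    simp only [add_comm K]
  have := ha1 n
  rw [e]
  refine div_le_div_of_nonneg_right (mul_le_mul_of_nonneg_left ?_ (ha _)) (by norm_num)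
  linarith

end Necessity

/-! ### Conclusion for arbitrary infinite-dimensional spaces. -/

theorem ConvergesOn.mono {H : Type*} [NormedAddCommGroup H] [InnerProductSpace ℝ H] {D : Set H}
    {t : ℕ → ℝ} {S S' : Set H} (h : ConvergesOn D t S') (hS : S ⊆ S') : ConvergesOn D t S :=
  fun f hf => h f (hS hf)

theorem liminfCondition_of_convergesOn {H : Type*} [NormedAddCommGroup H] [InnerProductSpace ℝ H]
    [CompleteSpace H] (hH : ¬ FiniteDimensional ℝ H) {t : ℕ → ℝ} (ht : IsWeaknessSequence t)
    (h : ∀ D : Set H, IsDictionary D → ConvergesOn D t (octahedron D)) : LiminfCondition t := by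
  by_contra hL
  obtain ⟨w, b, -⟩ := exists_hilbertBasis ℝ H
  have : Infinite w := by
    by_contra hfin
    rw [not_infinite_iff_finite] at hfin
    have := Fintype.ofFinite w
    exact hH (b.toOrthonormalBasis.toBasis.finiteDimensional_of_finite)
  exact (hasDivergentRealization_of_not_liminfCondition b.orthonormal ht hL).not_convergesOn
    (h _ (isDictionary_differenceDictionary b))

end WeakGreedy

theorem theorem6p3 {H : Type*} [NormedAddCommGroup H] [InnerProductSpace ℝ H] [CompleteSpace H]
    (t : ℕ → ℝ) (ht : WeakGreedy.IsWeaknessSequence t) :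
    -- sufficiency, in every real Hilbert space
    (WeakGreedy.LiminfCondition t →
      ∀ D : Set H, WeakGreedy.IsDictionary D →
        WeakGreedy.ConvergesOn D t (WeakGreedy.octahedron D) ∧
        WeakGreedy.ConvergesOn D t Set.univ) ∧
    -- the criteria, in every infinite-dimensional real Hilbert space
    (¬ FiniteDimensional ℝ H →
      (WeakGreedy.LiminfCondition t ↔
        ∀ D : Set H, WeakGreedy.IsDictionary D →
          WeakGreedy.ConvergesOn D t (WeakGreedy.octahedron D)) ∧
      (WeakGreedy.LiminfCondition t ↔
        ∀ D : Set H, WeakGreedy.IsDictionary D →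
          WeakGreedy.ConvergesOn D t Set.univ)) := by 
  have hsuff : WeakGreedy.LiminfCondition t → ∀ D : Set H, WeakGreedy.IsDictionary D →
      WeakGreedy.ConvergesOn D t (WeakGreedy.octahedron D) ∧
      WeakGreedy.ConvergesOn D t Set.univ := fun hL D hD =>
    have h := hL.convergesOn_univ ht hD
    ⟨h.mono (Set.subset_univ _), h⟩
  refine ⟨hsuff, fun hH => ⟨⟨fun hL D hD => (hsuff hL D hD).1, fun h => ?_⟩,
    ⟨fun hL D hD => (hsuff hL D hD).2, fun h => ?_⟩⟩⟩
  · exact WeakGreedy.liminfCondition_of_convergesOn hH ht h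
  · exact WeakGreedy.liminfCondition_of_convergesOn hH ht fun D hD =>
      (h D hD).mono (Set.subset_univ _)
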